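/- Let $m\ge 0$ and let $\mathcal E,\mathcal E_*,\mathcal F$ be complex Hilbert spaces (of any dimension). Write $\mathbb B^m$ for the open unit ball of $\mathbb C^m$ and, for $\boldsymbol k\in\mathbb N^m$, $\gamma_{\boldsymbol k}=\frac{(k_1+\cdots+k_m)!}{k_1!\cdots k_m!}$. For a Hilbert space $\mathcal E$, let $$H^2_m\otimes\mathcal E=H^2_m(\mathcal E)=\Big\{f:\mathbb B^m\to\mathcal E \;:\; f(z)=\sum_{\boldsymbol k\in\mathbb N^m}a_{\boldsymbol k}z^{\boldsymbol k},\ a_{\boldsymbol k}\in\mathcal E,\ \|f\|^2=\sum_{\boldsymbol k}\frac{\|a_{\boldsymbol k}\|^2}{\gamma_{\boldsymbol k}}<\infty\Big\}$$ be the $\mathcal E$-valued Drury–Arveson space, i.e. the reproducing kernel Hilbert space on $\mathbb B^m$ with kernel $(1-\sum_{i=1}^m z_i\bar w_i)^{-1}I_{\mathcal E}$; it is a Hilbert module over $\mathbb C[z_1,\dots,z_m]$ under pointwise multiplication by polynomials. Let $\mathcal M(\mathcal E,\mathcal E_*)$ be the set of multipliers, that is, of holomorphic functions $\theta:\mathbb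 B^m\to\mathcal L(\mathcal E,\mathcal E_*)$ such that $\theta f\in H^2_m\otimes\mathcal E_*$ for all $f\in H^2_m\otimes\mathcal E$. Each $\theta\in\mathcal M(\mathcal E,\mathcal E_*)$ defines a bounded module map $M_\theta:H^2_m\otimes\mathcal E\to H^2_m\otimes\mathcal E_*$, $M_\theta f=\theta f$. Let $\theta\in\mathcal M(\mathcal E,\mathcal E_*)$ be such that $\operatorname{ran}M_\theta$ is closed, and let $\mathcal H_\theta=(H^2_m\otimes\mathcal E_*)/\operatorname{ran}M_\theta$ be the quotient Hilbert module. If $\mathcal H_\theta$ is similar to $H^2_m\otimes\mathcal F$, i.e. there is a bounded, boundedly invertible $\mathbb C[z_1,\dots,z_m]$-module map from $\mathcal H_\theta$ onto $H^2_m\otimes\mathcal F$, then there exists a multiplier $\psi\in\mathcal M(\mathcal E_*,\mathcal E)$ satisfying $$\theta(z)\,\psi(z)\,\theta(z)=\theta(z)\qquad\text{for all } z\in\mathbb B^m .$$ -/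

import Mathlib

open scoped ENNReal InnerProductSpace

noncomputable section

namespace DruryArveson

/-- The open unit ball of `ℂ^m` (with its Euclidean norm). -/
abbrev unitBall (m : ℕ) : Set (EuclideanSpace ℂ (Fin m)) := Metric.ball 0 1

/-- The function `√γ_k z^k`, where `γ_k = (k_1 + ... + k_m)! / (k_1! ... k_m!)`. -/
def weightedMonomial {m : ℕ} (k : Fin m → ℕ) (z : EuclideanSpace ℂ (Fin m)) : ℂ :=
  (√(Nat.multinomial Finset.univ k : ℝ) : ℝ) * ∏ i, z i ^ k i

/-- Multi-indices, sorted by their total degree. -/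
def degreeEquiv (m : ℕ) :
    (Σ n : ℕ, (Finset.piAntidiag (Finset.univ : Finset (Fin m)) n)) ≃ (Fin m → ℕ) where
  toFun p := p.2
  invFun k := ⟨∑ i, k i, k, by simp⟩
  left_inv := by
    rintro ⟨n, k, hk⟩
    have : ∑ i, k i = n := by simpa using hk
    subst this
    rfl
  right_inv k := rfl

lemma summable_multinomial {m : ℕ} (x : Fin m → ℝ) (h0 : ∀ i, 0 ≤ x i) (h1 : ∑ i, x i < 1) :
    Summable fun k : Fin m → ℕ => (Nat.multinomial Finset.univ k : ℝ) * ∏ i, x i ^ k i := by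
  rw [← (degreeEquiv m).summable_iff]
  have hnn : ∀ p, 0 ≤ ((fun k : Fin m → ℕ =>
      (Nat.multinomial Finset.univ k : ℝ) * ∏ i, x i ^ k i) ∘ degreeEquiv m) p := fun p =>
    mul_nonneg (Nat.cast_nonneg _) (Finset.prod_nonneg fun i _ => pow_nonneg (h0 i) _)
  rw [summable_sigma_of_nonneg hnn]
  refine ⟨fun n => (hasSum_fintype _).summable, ?_⟩
  have : ∀ n, ∑' y : (Finset.piAntidiag (Finset.univ : Finset (Fin m)) n),
      ((fun k : Fin m → ℕ =>
      (Nat.multinomial Finset.univ k : ℝ) * ∏ i, x i ^ k i) ∘ degreeEquiv m) ⟨n, y⟩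
      = (∑ i, x i) ^ n := by
    intro n
    rw [Finset.sum_pow_eq_sum_piAntidiag]
    exact Finset.tsum_subtype _ fun k : Fin m → ℕ =>
      (Nat.multinomial Finset.univ k : ℝ) * ∏ i, x i ^ k i
  simp only [this]
  exact summable_geometric_of_lt_one (Finset.sum_nonneg fun i _ => h0 i) h1

lemma hasSum_multinomial {m : ℕ} (x : Fin m → ℂ) (h1 : ∑ i, ‖x i‖ < 1) :
    HasSum (fun k : Fin m → ℕ => (Nat.multinomial Finset.univ k : ℂ) * ∏ i, x i ^ k i)
      (1 - ∑ i, x i)⁻¹ := by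
  have hs : Summable fun k : Fin m → ℕ =>
      (Nat.multinomial Finset.univ k : ℂ) * ∏ i, x i ^ k i := by
    apply Summable.of_norm
    simpa using summable_multinomial (fun i => ‖x i‖) (fun i => norm_nonneg _) h1
  have h2 := (degreeEquiv m).hasSum_iff.mpr hs.hasSum
  have h3 := h2.sigma (g := fun n => (∑ i, x i) ^ n) (fun n => by
    rw [Finset.sum_pow_eq_sum_piAntidiag]
    exact Finset.hasSum _ fun k : Fin m → ℕ =>
      (Nat.multinomial Finset.univ k : ℂ) * ∏ i, x i ^ k i)
  have h4 := hasSum_geometric_of_norm_lt_one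
    (ξ := ∑ i, x i) ((norm_sum_le _ _).trans_lt h1)
  rw [← h3.unique h4]
  exact hs.hasSum

lemma sum_mul_norm_lt_one {m : ℕ} (z w : unitBall m) : ∑ i, ‖z.1 i * star (w.1 i)‖ < 1 := by
  have hz : ‖z.1‖ < 1 := mem_ball_zero_iff.mp z.2
  have hw : ‖w.1‖ < 1 := mem_ball_zero_iff.mp w.2
  have hz2 : ∑ i, ‖z.1 i‖ ^ 2 < 1 := by
    rw [← EuclideanSpace.norm_sq_eq]; nlinarith [norm_nonneg z.1]
  have hw2 : ∑ i, ‖w.1 i‖ ^ 2 < 1 := by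
    rw [← EuclideanSpace.norm_sq_eq]; nlinarith [norm_nonneg w.1]
  have : ∑ i, ‖z.1 i * star (w.1 i)‖ ≤ ∑ i, (‖z.1 i‖ ^ 2 + ‖w.1 i‖ ^ 2) / 2 := by
    apply Finset.sum_le_sum
    intro i _
    rw [norm_mul, norm_star]
    nlinarith [sq_nonneg (‖z.1 i‖ - ‖w.1 i‖)]
  rw [← Finset.sum_div, Finset.sum_add_distrib] at this
  linarith

lemma weightedMonomial_mul_star {m : ℕ} (k : Fin m → ℕ) (z w : EuclideanSpace ℂ (Fin m)) :
    weightedMonomial k z * star (weightedMonomial k w) =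
      (Nat.multinomial Finset.univ k : ℂ) * ∏ i, (z i * star (w i)) ^ k i := by
  have h : ((√(Nat.multinomial Finset.univ k : ℝ) : ℝ) : ℂ) *
      ((√(Nat.multinomial Finset.univ k : ℝ) : ℝ) : ℂ) = (Nat.multinomial Finset.univ k : ℂ) := by
    rw [← Complex.ofReal_mul, Real.mul_self_sqrt (Nat.cast_nonneg _), Complex.ofReal_natCast]
  simp only [weightedMonomial, star_mul', star_prod, star_pow, mul_pow, Finset.prod_mul_distrib]
  rw [← h]
  simp only [RCLike.star_def, Complex.conj_ofReal]
  ring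

lemma hasSum_weightedMonomial {m : ℕ} (z w : unitBall m) :
    HasSum (fun k => weightedMonomial k z.1 * star (weightedMonomial k w.1))
      (1 - ∑ i, z.1 i * star (w.1 i))⁻¹ := by
  simp only [weightedMonomial_mul_star]
  exact hasSum_multinomial _ (sum_mul_norm_lt_one z w)

lemma summable_norm_sq_weightedMonomial {m : ℕ} (z : unitBall m) :
    Summable fun k => ‖weightedMonomial k z.1‖ ^ 2 := by
  have := (hasSum_weightedMonomial z z).summable.norm
  simpa [norm_mul, ← sq] using this

variable {m : ℕ} {E : Type*} [NormedAddCommGroup E] [InnerProductSpace ℂ E]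

set_option linter.unusedSectionVars false

/-- The Hilbert space `H²_m ⊗ E = H²_m(E)`, described in the orthonormal coordinates
`√γ_k z^k`: the family `(c_k)` in `ℓ²(ℕ^m, E)` stands for the holomorphic function
`f(z) = ∑ a_k z^k` on the unit ball with `a_k = √γ_k c_k`, so that
`‖f‖² = ∑ ‖c_k‖² = ∑ ‖a_k‖² / γ_k`. Its elements are coerced to these functions below. -/
def H2 (m : ℕ) (E : Type*) [NormedAddCommGroup E] : Type _ :=
  lp (fun _ : Fin m → ℕ => E) 2

instance : NormedAddCommGroup (H2 m E) :=
  inferInstanceAs (NormedAddCommGroup (lp (fun _ : Fin m → ℕ => E) 2))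

instance : InnerProductSpace ℂ (H2 m E) :=
  inferInstanceAs (InnerProductSpace ℂ (lp (fun _ : Fin m → ℕ => E) 2))

instance [CompleteSpace E] : CompleteSpace (H2 m E) :=
  inferInstanceAs (CompleteSpace (lp (fun _ : Fin m → ℕ => E) 2))

/-- The coordinate `c_k` of `f` with respect to `√γ_k z^k`. -/
def coord (f : H2 m E) (k : Fin m → ℕ) : E :=
  (show lp (fun _ : Fin m → ℕ => E) 2 from f) k

lemma summable_coord (f : H2 m E) : Summable fun k => ‖coord f k‖ ^ 2 := by
  have := (memℓp_gen_iff (p := 2) (by simp)).mp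
    (lp.memℓp (show lp (fun _ : Fin m → ℕ => E) 2 from f))
  simp only [ENNReal.toReal_ofNat, Real.rpow_two] at this
  exact this

lemma norm_sq_eq (f : H2 m E) : ‖f‖ ^ 2 = ∑' k, ‖coord f k‖ ^ 2 := by
  have := lp.norm_rpow_eq_tsum (p := 2) (by simp)
    (show lp (fun _ : Fin m → ℕ => E) 2 from f)
  simp only [ENNReal.toReal_ofNat, Real.rpow_two] at this
  exact this

lemma inner_eq (f g : H2 m E) : ⟪f, g⟫_ℂ = ∑' k, ⟪coord f k, coord g k⟫_ℂ := rfl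

lemma coord_ext {f g : H2 m E} (h : ∀ k, coord f k = coord g k) : f = g :=
  lp.ext (funext h)

lemma coord_add (f g : H2 m E) (k) : coord (f + g) k = coord f k + coord g k := rfl

lemma coord_smul (a : ℂ) (f : H2 m E) (k) : coord (a • f) k = a • coord f k := rfl

/-- The element with prescribed square-summable coordinates. -/
def ofCoord (c : (Fin m → ℕ) → E) (hc : Summable fun k => ‖c k‖ ^ 2) : H2 m E :=
  (⟨c, (memℓp_gen_iff (p := 2) (by simp)).mpr (by simpa using hc)⟩ :
    lp (fun _ : Fin m → ℕ => E) 2)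

lemma coord_ofCoord (c : (Fin m → ℕ) → E) (hc) (k) : coord (ofCoord c hc) k = c k := rfl

lemma summable_norm_eval (f : H2 m E) (z : unitBall m) :
    Summable (fun k => ‖weightedMonomial k z.1‖ * ‖coord f k‖) ∧
      ∑' k, ‖weightedMonomial k z.1‖ * ‖coord f k‖ ≤
        √(∑' k, ‖weightedMonomial k z.1‖ ^ 2) * ‖f‖ := by
  have h := Real.summable_and_inner_le_Lp_mul_Lq_tsum_of_nonneg Real.HolderConjugate.two_two
    (f := fun k => ‖weightedMonomial k z.1‖) (g := fun k => ‖coord f k‖)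
    (fun _ => norm_nonneg _) (fun _ => norm_nonneg _)
    (by simpa using summable_norm_sq_weightedMonomial z) (by simpa using summable_coord f)
  refine ⟨h.1, h.2.trans_eq ?_⟩
  rw [← Real.sqrt_eq_rpow, ← Real.sqrt_eq_rpow]
  simp only [Real.rpow_two]
  rw [← norm_sq_eq, Real.sqrt_sq (norm_nonneg _)]

variable [CompleteSpace E]

lemma summable_eval (f : H2 m E) (z : unitBall m) :
    Summable fun k => weightedMonomial k z.1 • coord f k :=
  Summable.of_norm (by simpa [norm_smul] using (summable_norm_eval f z).1)

/-- Evaluation at a point of the ball: `f ↦ ∑ √γ_k z^k c_k`. -/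
def evalCLM (z : unitBall m) : H2 m E →L[ℂ] E :=
  LinearMap.mkContinuous
    { toFun := fun f => ∑' k, weightedMonomial k z.1 • coord f k
      map_add' := fun f g => by
        simp only [coord_add, smul_add]
        exact (summable_eval f z).tsum_add (summable_eval g z)
      map_smul' := fun a f => by
        simp only [coord_smul, smul_comm _ a, RingHom.id_apply]
        exact (summable_eval f z).tsum_const_smul a }
    (√(∑' k, ‖weightedMonomial k z.1‖ ^ 2))
    (fun f => by
      refine le_trans ?_ (summable_norm_eval f z).2
      refine (norm_tsum_le_tsum_norm ?_).trans_eq ?_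
      · simpa [norm_smul] using (summable_norm_eval f z).1
      · simp [norm_smul])

lemma hasSum_evalCLM (f : H2 m E) (z : unitBall m) :
    HasSum (fun k => weightedMonomial k z.1 • coord f k) (evalCLM z f) :=
  (summable_eval f z).hasSum

lemma weightedMonomial_smul (t : ℂ) (z : EuclideanSpace ℂ (Fin m)) (k : Fin m → ℕ) :
    weightedMonomial k (t • z) = t ^ (∑ i, k i) * weightedMonomial k z := by
  simp only [weightedMonomial, PiLp.smul_apply, smul_eq_mul, mul_pow, Finset.prod_mul_distrib,
    Finset.prod_pow_eq_pow_sum]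
  ring

/-- The homogeneous parts of a function that vanishes on the ball vanish. -/
lemma homogeneous_part_eq_zero (f : H2 m E) (hf : ∀ z : unitBall m, evalCLM z f = 0) (n : ℕ)
    (z : EuclideanSpace ℂ (Fin m)) :
    ∑ k ∈ Finset.piAntidiag Finset.univ n, weightedMonomial k z • coord f k = 0 := by
  have key : ∀ (z : unitBall m) (n : ℕ),
      ∑ k ∈ Finset.piAntidiag Finset.univ n, weightedMonomial k z.1 • coord f k = 0 := by
    intro z n
    let p : FormalMultilinearSeries ℂ ℂ E := fun n => ContinuousMultilinearMap.mkPiRing ℂ (Fin n)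
      (∑ k ∈ Finset.piAntidiag Finset.univ n, weightedMonomial k z.1 • coord f k)
    have hp : ∀ n, p.coeff n =
        ∑ k ∈ Finset.piAntidiag Finset.univ n, weightedMonomial k z.1 • coord f k := by
      intro n
      simp [p, FormalMultilinearSeries.coeff]
    have h0 : HasFPowerSeriesAt (0 : ℂ → E) p 0 := by
      rw [hasFPowerSeriesAt_iff]
      filter_upwards [Metric.ball_mem_nhds (0 : ℂ) one_pos] with t ht
      have ht1 : ‖t‖ < 1 := by simpa using ht
      have hz : ‖z.1‖ < 1 := mem_ball_zero_iff.mp z.2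
      let tz : unitBall m := ⟨t • z.1, by
        rw [mem_ball_zero_iff, norm_smul]
        nlinarith [norm_nonneg t, norm_nonneg z.1]⟩
      have h2 := (degreeEquiv m).hasSum_iff.mpr (hasSum_evalCLM f tz)
      rw [hf tz] at h2
      refine h2.sigma (fun n => ?_)
      rw [hp, Finset.smul_sum]
      refine (Finset.hasSum (Finset.piAntidiag Finset.univ n)
        (fun k : Fin m → ℕ => t ^ n • weightedMonomial k z.1 • coord f k)).congr_fun ?_
      intro k
      have hk : ∑ i, k.1 i = n := (Finset.mem_piAntidiag.mp k.2).1
      simp [degreeEquiv, tz, weightedMonomial_smul, hk, mul_smul]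
    rw [← hp, h0.eq_zero]
    rfl
  obtain ⟨r, hr0, hr⟩ : ∃ r : ℂ, r ≠ 0 ∧ r • z ∈ unitBall m := by
    refine ⟨((‖z‖ + 1)⁻¹ : ℝ), ?_, ?_⟩
    · have : (‖z‖ + 1)⁻¹ ≠ 0 := by positivity
      exact_mod_cast this
    · rw [mem_ball_zero_iff, norm_smul, Complex.norm_real, Real.norm_eq_abs,
        abs_of_pos (by positivity), inv_mul_lt_iff₀ (by positivity)]
      linarith
  have h := key ⟨r • z, hr⟩ n
  have h' : r ^ n • ∑ k ∈ Finset.piAntidiag Finset.univ n, weightedMonomial k z • coord f k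
      = 0 := by
    rw [← h, Finset.smul_sum]
    refine Finset.sum_congr rfl fun k hk => ?_
    have hk : ∑ i, k i = n := by simpa using hk
    rw [weightedMonomial_smul, hk, mul_smul]
  exact (smul_eq_zero.mp h').resolve_left (pow_ne_zero _ hr0)

lemma eq_zero_of_evalCLM_eq_zero (f : H2 m E) (hf : ∀ z : unitBall m, evalCLM z f = 0) :
    f = 0 := by
  apply coord_ext
  intro k
  change coord f k = 0
  refine ext_inner_left ℂ fun u => ?_
  rw [inner_zero_right]
  set n := ∑ i, k i with hn
  let e : (Fin m → ℕ) ≃ (Fin m →₀ ℕ) := Finsupp.equivFunOnFinite.symm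
  let P : MvPolynomial (Fin m) ℂ := ∑ j ∈ Finset.piAntidiag Finset.univ n,
    MvPolynomial.monomial (e j)
      (((√(Nat.multinomial Finset.univ j : ℝ) : ℝ) : ℂ) * ⟪u, coord f j⟫_ℂ)
  have hP : P = 0 := by
    apply MvPolynomial.funext
    intro x
    have h := congrArg (fun v => ⟪u, v⟫_ℂ) (homogeneous_part_eq_zero f hf n (WithLp.toLp 2 x))
    simp only [inner_sum, inner_smul_right, inner_zero_right] at h
    simp only [P, map_sum, map_zero, MvPolynomial.eval_monomial]
    rw [← h]
    refine Finset.sum_congr rfl fun j _ => ?_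
    simp only [weightedMonomial, e]
    rw [Finsupp.prod_fintype _ _ (fun i => pow_zero _)]
    simp only [Finsupp.equivFunOnFinite_symm_apply_apply]
    ring
  have hc : P.coeff (e k) = 0 := by rw [hP]; simp
  simp only [P, MvPolynomial.coeff_sum, MvPolynomial.coeff_monomial, e.injective.eq_iff] at hc
  rw [Finset.sum_ite_eq' _ k, if_pos (by simp [hn])] at hc
  refine (mul_eq_zero.mp hc).resolve_left ?_
  have : 0 < √(Nat.multinomial Finset.univ k : ℝ) :=
    Real.sqrt_pos.mpr (Nat.cast_pos.mpr (Nat.multinomial_pos _ _))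
  exact_mod_cast this.ne'

/-- `H²_m(E)` as a Hilbert space of `E`-valued functions on the unit ball. -/
instance : RKHS ℂ (H2 m E) (unitBall m) E where
  coeCLM := ContinuousLinearMap.pi evalCLM
  coeCLM_injective := by
    refine (injective_iff_map_eq_zero _).mpr fun f h => ?_
    exact eq_zero_of_evalCLM_eq_zero f fun z => congrFun h z

lemma hasSum_apply (f : H2 m E) (z : unitBall m) :
    HasSum (fun k => weightedMonomial k z.1 • coord f k) (f z) :=
  hasSum_evalCLM f z

/-- The reproducing kernel of `H²_m(E)` is `(1 - ∑ z_i conj(w_i))⁻¹ I_E`. -/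
theorem kernel_eq (z w : unitBall m) :
    RKHS.kernel (H2 m E) z w =
      (1 - ∑ i, z.1 i * star (w.1 i))⁻¹ • ContinuousLinearMap.id ℂ E := by
  ext v
  have hc : Summable fun k : Fin m → ℕ => ‖star (weightedMonomial k w.1) • v‖ ^ 2 := by
    simpa [norm_smul, mul_pow] using (summable_norm_sq_weightedMonomial w).mul_right (‖v‖ ^ 2)
  have hk : RKHS.kerFun (H2 m E) w v = ofCoord _ hc := by
    refine ext_inner_right ℂ fun f => ?_
    rw [RKHS.kerFun_inner, inner_eq]
    simp only [coord_ofCoord, inner_smul_left]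
    have h := (hasSum_apply f w).mapL (innerSL ℂ v)
    rw [← innerSL_apply_apply ℂ, ← h.tsum_eq]
    simp
  rw [← RKHS.kerFun_apply, hk]
  refine (hasSum_apply _ z).unique ?_
  simp only [coord_ofCoord, smul_smul]
  exact (hasSum_weightedMonomial z w).smul_const v

variable {E' : Type*} [NormedAddCommGroup E'] [InnerProductSpace ℂ E'] [CompleteSpace E']

/-- The class `M(E, E')` of multipliers: holomorphic functions `θ : 𝔹^m → L(E, E')` with
`θ f ∈ H²_m(E')` for all `f ∈ H²_m(E)`. Values outside the ball are never used. -/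
structure IsMultiplier (θ : EuclideanSpace ℂ (Fin m) → E →L[ℂ] E') : Prop where
  holomorphic : DifferentiableOn ℂ θ (unitBall m)
  exists_mul : ∀ f : H2 m E, ∃ g : H2 m E', ∀ z : unitBall m, g z = θ z (f z)

namespace IsMultiplier

variable {θ : EuclideanSpace ℂ (Fin m) → E →L[ℂ] E'}

/-- The product `θ f`. -/
def mul (hθ : IsMultiplier θ) (f : H2 m E) : H2 m E' := (hθ.exists_mul f).choose

@[simp]
lemma mul_apply (hθ : IsMultiplier θ) (f : H2 m E) (z : unitBall m) :
    hθ.mul f z = θ z (f z) := (hθ.exists_mul f).choose_spec z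

lemma continuous_mul (hθ : IsMultiplier θ) : Continuous hθ.mul := by
  let L : H2 m E →ₗ[ℂ] H2 m E' :=
    { toFun := hθ.mul
      map_add' := fun f g => RKHS.ext fun z => by simp
      map_smul' := fun a f => RKHS.ext fun z => by simp }
  refine L.continuous_of_seq_closed_graph fun u x y hu hLu => ?_
  refine RKHS.ext fun z => ?_
  have h1 := ((RKHS.continuous_eval (H := H2 m E') z).tendsto y).comp hLu
  have h2 := ((θ z).continuous.tendsto (x z)).comp
    (((RKHS.continuous_eval (H := H2 m E) z).tendsto x).comp hu)
  refine tendsto_nhds_unique h1 ?_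
  have h3 : L x z = θ z (x z) := hθ.mul_apply x z
  rw [h3]
  refine h2.congr fun n => ?_
  exact (hθ.mul_apply (u n) z).symm

end IsMultiplier

/-! ### The module structure over the polynomials -/

lemma multinomial_le_add_single (k : Fin m → ℕ) (i : Fin m) :
    Nat.multinomial Finset.univ k ≤ Nat.multinomial Finset.univ (k + Pi.single i 1) := by
  have h1 := Nat.multinomial_spec Finset.univ k
  have h2 := Nat.multinomial_spec Finset.univ (k + Pi.single i 1)
  have hs : ∑ j, (k + Pi.single i 1 : Fin m → ℕ) j = ∑ j, k j + 1 := by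
    simp [Finset.sum_add_distrib]
  have hp : ∏ j, ((k + Pi.single i 1 : Fin m → ℕ) j).factorial = (k i + 1) * ∏ j, (k j).factorial := by
    rw [← Finset.mul_prod_erase _ _ (Finset.mem_univ i),
      ← Finset.mul_prod_erase _ (fun j => (k j).factorial) (Finset.mem_univ i), ← mul_assoc]
    congr 1
    · simp [Nat.factorial_succ]
    · refine Finset.prod_congr rfl fun j hj => ?_
      simp [Pi.single_eq_of_ne (Finset.ne_of_mem_erase hj)]
  rw [hs, hp, Nat.factorial_succ, ← h1] at h2
  have hP : 0 < ∏ j, (k j).factorial := Finset.prod_pos fun j _ => Nat.factorial_pos _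
  have h3 : (k i + 1) * Nat.multinomial Finset.univ (k + Pi.single i 1) =
      (∑ j, k j + 1) * Nat.multinomial Finset.univ k := by
    apply Nat.eq_of_mul_eq_mul_left hP
    linarith [h2]
  have h4 : k i ≤ ∑ j, k j := Finset.single_le_sum (fun _ _ => Nat.zero_le _) (Finset.mem_univ i)
  have h5 : (k i + 1) * Nat.multinomial Finset.univ k ≤
      (k i + 1) * Nat.multinomial Finset.univ (k + Pi.single i 1) := by
    rw [h3]
    exact Nat.mul_le_mul_right _ (by omega)
  exact Nat.le_of_mul_le_mul_left h5 (Nat.succ_pos _)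

/-- Multiplication by a coordinate function maps `H²_m(E)` to itself. -/
lemma exists_coordinate_mul (i : Fin m) (f : H2 m E) :
    ∃ g : H2 m E, ∀ z : unitBall m, g z = z.1 i • f z := by
  classical
  let s : (Fin m → ℕ) → (Fin m → ℕ) := fun k => k + Pi.single i 1
  have hs : Function.Injective s := add_left_injective _
  let r : (Fin m → ℕ) → ℝ := fun k =>
    √(Nat.multinomial Finset.univ k : ℝ) / √(Nat.multinomial Finset.univ (s k) : ℝ)
  have hr0 : ∀ k, 0 ≤ r k := fun k => by positivity
  have hr1 : ∀ k, r k ≤ 1 := fun k => by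
    apply div_le_one_of_le₀ _ (Real.sqrt_nonneg _)
    exact Real.sqrt_le_sqrt (Nat.cast_le.mpr (multinomial_le_add_single k i))
  let c : (Fin m → ℕ) → E := Function.extend s (fun k => (r k : ℂ) • coord f k) 0
  have hcs : ∀ k, c (s k) = (r k : ℂ) • coord f k := fun k => hs.extend_apply _ _ k
  have hc0 : ∀ k, k ∉ Set.range s → c k = 0 := fun k hk =>
    Function.extend_apply' _ _ _ (by simpa using hk)
  have hc : Summable fun k => ‖c k‖ ^ 2 := by
    rw [← hs.summable_iff (fun k hk => by simp [hc0 k hk])]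
    refine (summable_coord f).of_nonneg_of_le (fun k => sq_nonneg _) fun k => ?_
    simp only [Function.comp_apply, hcs, norm_smul, Complex.norm_real, Real.norm_eq_abs,
      abs_of_nonneg (hr0 k), mul_pow]
    exact mul_le_of_le_one_left (by positivity) (pow_le_one₀ (hr0 k) (hr1 k))
  refine ⟨ofCoord c hc, fun z => (hasSum_apply _ z).unique ?_⟩
  rw [← hs.hasSum_iff (fun k hk => by simp [coord_ofCoord, hc0 k hk])]
  refine ((hasSum_apply f z).const_smul (z.1 i)).congr_fun fun k => ?_
  simp only [Function.comp_apply, coord_ofCoord, hcs, smul_smul]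
  congr 1
  have h1 : ∏ j, z.1 j ^ (s k) j = z.1 i * ∏ j, z.1 j ^ k j := by
    simp only [s, Pi.add_apply, pow_add, Finset.prod_mul_distrib]
    rw [mul_comm]
    congr 1
    rw [Finset.prod_eq_single i]
    · simp
    · intro j _ hj
      simp [Pi.single_eq_of_ne hj]
    · simp
  have h2 : (√(Nat.multinomial Finset.univ (s k) : ℝ)) * r k =
      √(Nat.multinomial Finset.univ k : ℝ) := by
    apply mul_div_cancel₀
    exact (Real.sqrt_pos.mpr (Nat.cast_pos.mpr (Nat.multinomial_pos _ _))).ne'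
  simp only [weightedMonomial, h1]
  rw [← h2]
  push_cast
  ring

lemma exists_polynomial_mul (p : MvPolynomial (Fin m) ℂ) (f : H2 m E) :
    ∃ g : H2 m E, ∀ z : unitBall m, g z = MvPolynomial.eval (fun i => z.1 i) p • f z := by
  induction p using MvPolynomial.induction_on generalizing f with
  | C a => exact ⟨a • f, fun z => by simp⟩
  | add p q hp hq =>
    obtain ⟨g, hg⟩ := hp f
    obtain ⟨h, hh⟩ := hq f
    exact ⟨g + h, fun z => by simp [hg, hh, add_smul]⟩
  | mul_X p i hp =>
    obtain ⟨g, hg⟩ := exists_coordinate_mul i f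
    obtain ⟨h, hh⟩ := hp g
    exact ⟨h, fun z => by simp [hg, hh, mul_smul]⟩

/-- `p • f` is the pointwise product, for a polynomial `p` and `f ∈ H²_m(E)`. -/
instance : SMul (MvPolynomial (Fin m) ℂ) (H2 m E) where
  smul p f := (exists_polynomial_mul p f).choose

@[simp]
lemma polynomial_smul_apply (p : MvPolynomial (Fin m) ℂ) (f : H2 m E) (z : unitBall m) :
    (p • f) z = MvPolynomial.eval (fun i => z.1 i) p • f z :=
  (exists_polynomial_mul p f).choose_spec z

/-- `H²_m(E)` as a Hilbert module over `ℂ[z_1, ..., z_m]`: the module action is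
multiplication, so the coordinate function `z_i` acts as the operator `M_{z_i} ⊗ I_E`. -/
instance : Module (MvPolynomial (Fin m) ℂ) (H2 m E) where
  one_smul f := RKHS.ext fun z => by simp
  mul_smul p q f := RKHS.ext fun z => by simp [mul_smul]
  smul_zero p := RKHS.ext fun z => by simp
  smul_add p f g := RKHS.ext fun z => by simp
  add_smul p q f := RKHS.ext fun z => by simp [add_smul]
  zero_smul f := RKHS.ext fun z => by simp

instance : IsScalarTower ℂ (MvPolynomial (Fin m) ℂ) (H2 m E) where
  smul_assoc a p f := RKHS.ext fun z => by simp [mul_smul]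

/-- The bounded module map `M_θ : H²_m(E) → H²_m(E')`, `f ↦ θ f`. -/
def IsMultiplier.mulOp {θ : EuclideanSpace ℂ (Fin m) → E →L[ℂ] E'} (hθ : IsMultiplier θ) :
    H2 m E →L[MvPolynomial (Fin m) ℂ] H2 m E' where
  toFun := hθ.mul
  map_add' f g := RKHS.ext fun z => by simp
  map_smul' p f := RKHS.ext fun z => by simp
  cont := hθ.continuous_mul

@[simp]
lemma IsMultiplier.mulOp_apply {θ : EuclideanSpace ℂ (Fin m) → E →L[ℂ] E'}
    (hθ : IsMultiplier θ) (f : H2 m E) (z : unitBall m) : hθ.mulOp f z = θ z (f z) :=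
  hθ.mul_apply f z

/-- The quotient module `H_θ = H²_m(E') / ran M_θ` with its quotient topology. -/
abbrev IsMultiplier.QuotientModule {θ : EuclideanSpace ℂ (Fin m) → E →L[ℂ] E'}
    (hθ : IsMultiplier θ) : Type _ :=
  H2 m E' ⧸ LinearMap.range (hθ.mulOp : H2 m E →ₗ[MvPolynomial (Fin m) ℂ] H2 m E')

/-- Two topological modules over `ℂ[z_1, ..., z_m]` are similar if there is a bounded module map
with bounded inverse between them. -/
def Similar (m : ℕ) (H K : Type*) [TopologicalSpace H] [AddCommMonoid H]
    [Module (MvPolynomial (Fin m) ℂ) H] [TopologicalSpace K] [AddCommMonoid K]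
    [Module (MvPolynomial (Fin m) ℂ) K] : Prop :=
  Nonempty (H ≃L[MvPolynomial (Fin m) ℂ] K)

end DruryArveson

end

/-! Composing the quotient map with the similarity gives a surjective module map `Φ : H²(E') →
H²(F)` with kernel `ran M_θ`. If `Φ` has a right inverse `η` that is itself a module map, then `1 -
ηΦ` is a module projection onto `ran M_θ`. If moreover `1 - ηΦ = M_θ Ψ` for a module map `Ψ`, then
`M_θ Ψ M_θ = M_θ`, because `Φ M_θ = 0`. Module maps are multiplication operators, so the symbol of
`Ψ` is the required `ψ`.

Both factorizations are instances of Leech's theorem (`exists_moduleMap_factor`): `ran B ⊆ ran A`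
implies `B = A C` with `C` a module map. Douglas' lemma supplies a bounded factor, hence `B B* ≤ A
A*` after rescaling `A`, but that factor need not commute with the shift. The module map comes from
a lurking isometry argument. Write `A A* - B B* = S* S` and test on kernel functions. Since the
reciprocal of the kernel is `1 - ∑ w_i conj(z_i)`, multiplying by it turns the identity into an
equality of Gram matrices, and so yields a contraction `V : E ⊕ K^m → E' ⊕ K`. The transfer function
of `V` is contractive on kernel functions because `∑ M_{z_i} M_{z_i}^* ≤ 1`, and its adjoint is `C`.

A module map is a multiplication operator because its adjoint preserves joint eigenvectors of the
backward shifts, which are exactly the kernel functions. Holomorphy of the symbol follows from a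
resolvent formula based on Gleason's identity. -/

noncomputable section

namespace DruryArveson

set_option linter.unusedSectionVars false

/-! ### Contractions and factorizations of Hilbert space operators -/

section

variable {H K L : Type*} [NormedAddCommGroup H] [InnerProductSpace ℂ H] [CompleteSpace H]
  [NormedAddCommGroup K] [InnerProductSpace ℂ K] [CompleteSpace K]
  [NormedAddCommGroup L] [InnerProductSpace ℂ L]

/-- A linear map dominated by another one factors through it by a contraction. -/
lemma exists_contraction_of_norm_le {X : Type*} [AddCommGroup X] [Module ℂ X]
    (P : X →ₗ[ℂ] H) (Q : X →ₗ[ℂ] K) (h : ∀ x, ‖Q x‖ ≤ ‖P x‖) :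
    ∃ V : H →L[ℂ] K, (∀ u, ‖V u‖ ≤ ‖u‖) ∧ ∀ x, V (P x) = Q x := by
  let S := (LinearMap.range P).topologicalClosure
  have hmem : ∀ x, P x ∈ S := fun x =>
    Submodule.le_topologicalClosure _ (LinearMap.mem_range_self P x)
  let e : X →ₗ[ℂ] S := P.codRestrict S hmem
  have hd : DenseRange e := by
    intro y
    rw [Topology.IsInducing.subtypeVal.closure_eq_preimage_closure_image]
    have hy : (y : H) ∈ closure (LinearMap.range P : Set H) := y.2
    refine closure_mono ?_ hy
    rintro _ ⟨x, rfl⟩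
    exact ⟨e x, ⟨x, rfl⟩, rfl⟩
  have hn : ∀ x, ‖Q x‖ ≤ 1 * ‖e x‖ := fun x => by
    rw [one_mul]
    exact h x
  have : CompleteSpace S := (Submodule.isClosed_topologicalClosure _).completeSpace_coe
  -- `V` is the extension by continuity to the closure of `ran P`, and zero on its orthogonal
  -- complement.
  refine ⟨(Q.extendOfNorm e) ∘L S.orthogonalProjectionOnto, fun u => ?_, fun x => ?_⟩
  · refine (LinearMap.norm_extendOfNorm_apply_le hd 1 hn _).trans ?_
    rw [one_mul]
    exact S.norm_orthogonalProjectionOnto_apply_le u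
  · have h1 : S.orthogonalProjectionOnto (P x) = e x :=
      S.orthogonalProjectionOnto_mem_subspace_eq_self (e x)
    rw [ContinuousLinearMap.comp_apply, h1]
    exact LinearMap.extendOfNorm_eq hd ⟨1, hn⟩ x

/-- Families with equal Gram matrices are intertwined by a contraction. -/
lemma exists_contraction_of_inner_eq {ι : Type*} (p : ι → L →L[ℂ] H) (q : ι → L →L[ℂ] K)
    (h : ∀ i j x y, ⟪q i x, q j y⟫_ℂ = ⟪p i x, p j y⟫_ℂ) :
    ∃ V : H →L[ℂ] K, (∀ u, ‖V u‖ ≤ ‖u‖) ∧ ∀ i x, V (p i x) = q i x := by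
  let P : (ι →₀ L) →ₗ[ℂ] H := Finsupp.lsum ℂ fun i => (p i : L →ₗ[ℂ] H)
  let Q : (ι →₀ L) →ₗ[ℂ] K := Finsupp.lsum ℂ fun i => (q i : L →ₗ[ℂ] K)
  obtain ⟨V, hV, hPQ⟩ := exists_contraction_of_norm_le P Q fun c => by
    have : ⟪Q c, Q c⟫_ℂ = ⟪P c, P c⟫_ℂ := by
      simp only [P, Q, Finsupp.lsum_apply, Finsupp.sum, sum_inner, inner_sum,
        ContinuousLinearMap.coe_coe, h]
    refine (pow_le_pow_iff_left₀ (norm_nonneg _) (norm_nonneg _) two_ne_zero).mp ?_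
    have h2 := congrArg Complex.re this
    rw [← inner_self_eq_norm_sq (𝕜 := ℂ), ← inner_self_eq_norm_sq (𝕜 := ℂ)]
    exact h2.le
  refine ⟨V, hV, fun i x => ?_⟩
  simpa [P, Q] using hPQ (Finsupp.single i x)

/-- Douglas' lemma: range inclusion implies a factorization. -/
lemma exists_factor_of_range_subset (A : H →L[ℂ] L) (B : K →L[ℂ] L)
    (h : ∀ x, ∃ y, A y = B x) : ∃ D : K →L[ℂ] H, A ∘L D = B := by
  let N := LinearMap.ker (A : H →ₗ[ℂ] L)
  have hN : IsClosed (N : Set H) := A.isClosed_ker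
  have : CompleteSpace N := hN.completeSpace_coe
  have hex : ∀ x, ∃ y : Nᗮ, A y = B x := fun x => by
    obtain ⟨y, hy⟩ := h x
    refine ⟨⟨y - N.starProjection y, N.sub_starProjection_mem_orthogonal y⟩, ?_⟩
    have h0 : A (N.starProjection y) = 0 := N.starProjection_apply_mem y
    simp [h0, hy]
  -- Solutions in the orthogonal complement of `ker A` are unique. This makes the chosen solution
  -- linear in `x` and its graph closed.
  have huniq : ∀ y y' : Nᗮ, A y = A y' → y = y' := fun y y' hyy => by
    have h1 : (y - y' : H) ∈ N := by simp [N, hyy]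
    have h2 : (y - y' : H) ∈ Nᗮ := Submodule.sub_mem _ y.2 y'.2
    have h3 := N.inner_right_of_mem_orthogonal h1 h2
    exact Subtype.ext (sub_eq_zero.mp (inner_self_eq_zero.mp h3))
  choose d hd using hex
  let D : K →ₗ[ℂ] Nᗮ :=
    { toFun := d
      map_add' := fun x y => huniq _ _ (by simp [hd])
      map_smul' := fun a x => huniq _ _ (by simp [hd]) }
  have hD : Continuous D := by
    refine D.continuous_of_seq_closed_graph fun u x y hu hDu => huniq _ _ ?_
    have h1 := ((A.continuous.comp continuous_subtype_val).tendsto y).comp hDu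
    have h2 := (B.continuous.tendsto x).comp hu
    refine (tendsto_nhds_unique h1 (h2.congr fun n => ?_)).trans (hd x).symm
    exact (hd (u n)).symm
  refine ⟨Nᗮ.subtypeL ∘L ⟨D, hD⟩, ?_⟩
  ext x
  exact hd x

/-- A positive difference `A A* - B B*` is of the form `G* G`. -/
lemma exists_factor_of_adjoint_norm_le [CompleteSpace L] (A : H →L[ℂ] L) (B : K →L[ℂ] L)
    (h : ∀ x, ‖B.adjoint x‖ ≤ ‖A.adjoint x‖) :
    ∃ G : L →L[ℂ] L, ∀ x y, ⟪A.adjoint x, A.adjoint y⟫_ℂ =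
      ⟪B.adjoint x, B.adjoint y⟫_ℂ + ⟪G x, G y⟫_ℂ := by
  have hpos : (0 : L →L[ℂ] L) ≤ A ∘L A.adjoint - B ∘L B.adjoint := by
    rw [ContinuousLinearMap.nonneg_iff_isPositive]
    refine ContinuousLinearMap.isPositive_def'.mpr
      ⟨(ContinuousLinearMap.isPositive_self_comp_adjoint A).isSelfAdjoint.sub
        (ContinuousLinearMap.isPositive_self_comp_adjoint B).isSelfAdjoint, fun x => ?_⟩
    have hA : ⟪(A ∘L A.adjoint) x, x⟫_ℂ = ⟪A.adjoint x, A.adjoint x⟫_ℂ := by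
      rw [ContinuousLinearMap.adjoint_inner_right]; rfl
    have hB : ⟪(B ∘L B.adjoint) x, x⟫_ℂ = ⟪B.adjoint x, B.adjoint x⟫_ℂ := by
      rw [ContinuousLinearMap.adjoint_inner_right]; rfl
    rw [ContinuousLinearMap.reApplyInnerSelf_apply, sub_apply,
      inner_sub_left, hA, hB, map_sub, inner_self_eq_norm_sq, inner_self_eq_norm_sq]
    have := h x
    have := norm_nonneg (B.adjoint x)
    nlinarith
  -- Positive elements of the C*-algebra of operators on `L` have the form `G* G`.
  obtain ⟨G, hG⟩ := CStarAlgebra.nonneg_iff_eq_star_mul_self.mp hpos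
  refine ⟨G, fun x y => ?_⟩
  have h1 := congrArg (fun T : L →L[ℂ] L => ⟪x, T y⟫_ℂ) hG
  simp only [sub_apply, inner_sub_right, ContinuousLinearMap.comp_apply,
    ContinuousLinearMap.star_eq_adjoint, mul_apply_eq_comp,
    ContinuousLinearMap.adjoint_inner_right] at h1
  rw [ContinuousLinearMap.adjoint_inner_left, ContinuousLinearMap.adjoint_inner_left, ← h1]
  ring

end

section

variable {m : ℕ}
  {E : Type*} [NormedAddCommGroup E] [InnerProductSpace ℂ E] [CompleteSpace E]
  {E' : Type*} [NormedAddCommGroup E'] [InnerProductSpace ℂ E'] [CompleteSpace E']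
  {E'' : Type*} [NormedAddCommGroup E''] [InnerProductSpace ℂ E''] [CompleteSpace E'']

/-! ### Kernel functions -/

lemma one_sub_sum_ne_zero (z w : unitBall m) : 1 - ∑ i, z.1 i * star (w.1 i) ≠ 0 := by
  intro h
  have h1 := (norm_sum_le Finset.univ fun i => z.1 i * star (w.1 i)).trans_lt
    (sum_mul_norm_lt_one z w)
  rw [← sub_eq_zero.mp h, norm_one] at h1
  exact lt_irrefl _ h1

lemma kerFun_apply_eq (w z : unitBall m) (v : E) :
    RKHS.kerFun (H2 m E) w v z = (1 - ∑ i, z.1 i * star (w.1 i))⁻¹ • v := by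
  rw [RKHS.kerFun_apply, kernel_eq]
  rfl

/-- Bounded operators that agree on the kernel functions are equal. -/
lemma ext_kerFun {H : Type*} [NormedAddCommGroup H] [NormedSpace ℂ H] {S T : H2 m E →L[ℂ] H}
    (h : ∀ w v, S (RKHS.kerFun (H2 m E) w v) = T (RKHS.kerFun (H2 m E) w v)) : S = T := by
  refine ContinuousLinearMap.ext_on
    (Submodule.dense_iff_topologicalClosure_eq_top.mpr (RKHS.kerFun_dense (H2 m E))) ?_
  rintro _ ⟨w, v, rfl⟩
  exact h w v

/-- The centre of the ball. -/
def origin (m : ℕ) : unitBall m := ⟨0, by simp⟩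

@[simp]
lemma kerFun_origin_apply (v : E) (z : unitBall m) :
    RKHS.kerFun (H2 m E) (origin m) v z = v := by
  simp [kerFun_apply_eq, origin]

/-! ### The shift -/

/-- Multiplication by the coordinate function `z_i`. -/
def shift (i : Fin m) : H2 m E →L[ℂ] H2 m E where
  toFun f := (MvPolynomial.X i : MvPolynomial (Fin m) ℂ) • f
  map_add' f g := smul_add _ f g
  map_smul' a f := RKHS.ext fun z => by simp [smul_comm a]
  cont := by
    -- Boundedness comes from the closed graph theorem for multipliers, applied to `z_i I`.
    have hθ : IsMultiplier (E := E) (E' := E)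
        fun z : EuclideanSpace ℂ (Fin m) => z i • ContinuousLinearMap.id ℂ E :=
      ⟨by fun_prop, fun f => exists_coordinate_mul i f⟩
    refine hθ.continuous_mul.congr fun f => RKHS.ext fun z => ?_
    simp

@[simp]
lemma shift_apply (i : Fin m) (f : H2 m E) (z : unitBall m) : shift i f z = z.1 i • f z := by
  change ((MvPolynomial.X i : MvPolynomial (Fin m) ℂ) • f) z = _
  simp

lemma adjoint_shift_kerFun (i : Fin m) (w : unitBall m) (v : E) :
    (shift i).adjoint (RKHS.kerFun (H2 m E) w v) =
      star (w.1 i) • RKHS.kerFun (H2 m E) w v := by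
  refine ext_inner_right ℂ fun f => ?_
  rw [ContinuousLinearMap.adjoint_inner_left, RKHS.kerFun_inner, shift_apply, inner_smul_right,
    inner_smul_left, RKHS.kerFun_inner]
  simp

/-- `∑ M_{z_i} M_{z_i}^*` is the projection onto the orthogonal complement of the constants. -/
lemma sum_shift_adjoint (f : H2 m E) :
    ∑ i, shift i ((shift i).adjoint f) = f - RKHS.kerFun (H2 m E) (origin m) (f (origin m)) := by
  have h : ∑ i, shift i ∘L (shift i).adjoint = ContinuousLinearMap.id ℂ (H2 m E) -
      RKHS.kerFun (H2 m E) (origin m) ∘L (RKHS.kerFun (H2 m E) (origin m)).adjoint := by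
    -- On `k_w v`, evaluated at `z`, the claim is `s / (1 - s) = 1 / (1 - s) - 1` with `s = ∑ z_i
    -- conj(w_i)`.
    refine ext_kerFun fun w v => RKHS.ext fun z => ?_
    rw [← RKHS.adjoint_kerFun z, ← RKHS.adjoint_kerFun z]
    simp only [sum_apply, ContinuousLinearMap.comp_apply, map_sum, adjoint_shift_kerFun,
      map_smul, RKHS.adjoint_kerFun, shift_apply, sub_apply, map_sub,
      ContinuousLinearMap.id_apply, kerFun_apply_eq, smul_smul, ← Finset.sum_smul, ← mul_assoc]
    have h0 := one_sub_sum_ne_zero z w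
    have h1 : (1 - ∑ i, (origin m).1 i * star (w.1 i)) = 1 := by simp [origin]
    have h2 : (1 - ∑ i, z.1 i * star ((origin m).1 i)) = 1 := by simp [origin]
    rw [h1, h2, inv_one, one_mul, ← sub_smul, ← Finset.sum_mul]
    congr 1
    rw [Finset.sum_congr rfl fun i _ => mul_comm (star (w.1 i)) (z.1 i)]
    field_simp
    ring
  have := congrArg (fun T : H2 m E →L[ℂ] H2 m E => T f) h
  simpa using this

/-- Gleason's identity `f(z) - f(0) = ∑ z_i (M_{z_i}^* f)(z)`. -/
lemma apply_eq_add_sum (f : H2 m E) (z : unitBall m) :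
    f z = f (origin m) + ∑ i, z.1 i • (shift i).adjoint f z := by
  have h := congrArg (fun g => (RKHS.kerFun (H2 m E) z).adjoint g) (sum_shift_adjoint f)
  simp only [map_sum, map_sub, RKHS.adjoint_kerFun, shift_apply, kerFun_origin_apply] at h
  rw [h]
  abel

/-- Pairing `sum_shift_adjoint` with `f` gives the exact value `‖f‖² - ‖f(0)‖²`. This row
contractivity is what makes transfer functions contractive. -/
lemma sum_norm_sq_adjoint_shift_le (f : H2 m E) : ∑ i, ‖(shift i).adjoint f‖ ^ 2 ≤ ‖f‖ ^ 2 := by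
  have h := congrArg (fun g => Complex.re ⟪f, g⟫_ℂ) (sum_shift_adjoint f)
  have h1 : ∀ i : Fin m, Complex.re ⟪f, shift i ((shift i).adjoint f)⟫_ℂ =
      ‖(shift i).adjoint f‖ ^ 2 := fun i => by
    rw [← ContinuousLinearMap.adjoint_inner_left]
    exact inner_self_eq_norm_sq (𝕜 := ℂ) _
  have h2 : Complex.re ⟪f, f⟫_ℂ = ‖f‖ ^ 2 := inner_self_eq_norm_sq (𝕜 := ℂ) _
  have h3 : Complex.re ⟪f (origin m), f (origin m)⟫_ℂ = ‖f (origin m)‖ ^ 2 :=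
    inner_self_eq_norm_sq (𝕜 := ℂ) _
  simp only [inner_sum, inner_sub_right, RKHS.inner_kerFun, Complex.re_sum, Complex.sub_re,
    h1, h2, h3] at h
  rw [h]
  exact sub_le_self _ (sq_nonneg _)

lemma norm_sum_smul_le {ι H : Type*} [Fintype ι] [NormedAddCommGroup H] [NormedSpace ℂ H]
    (z : EuclideanSpace ℂ ι) (x : ι → H) : ‖∑ i, z i • x i‖ ≤ ‖z‖ * √(∑ i, ‖x i‖ ^ 2) := by
  refine (norm_sum_le _ _).trans ?_
  rw [EuclideanSpace.norm_eq]
  simp only [norm_smul]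
  exact Real.sum_mul_le_sqrt_mul_sqrt _ _ _

/-- The operator `∑ z_i M_{z_i}^*`. -/
def gleason (z : EuclideanSpace ℂ (Fin m)) : H2 m E →L[ℂ] H2 m E :=
  ∑ i, z i • (shift i).adjoint

/-- Cauchy–Schwarz and row contractivity bound the norm by `‖z‖`, so `1 - gleason z` is invertible
on the whole ball. -/
lemma norm_gleason_lt_one (z : unitBall m) : ‖(gleason z.1 : H2 m E →L[ℂ] H2 m E)‖ < 1 := by
  refine lt_of_le_of_lt (ContinuousLinearMap.opNorm_le_bound _ (norm_nonneg z.1) fun f => ?_)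
    (mem_ball_zero_iff.mp z.2)
  have h : gleason z.1 f = ∑ i, z.1 i • (shift i).adjoint f := by simp [gleason]
  rw [h]
  refine (norm_sum_smul_le _ _).trans ?_
  gcongr
  exact (Real.sqrt_le_sqrt (sum_norm_sq_adjoint_shift_le f)).trans_eq (Real.sqrt_sq (norm_nonneg _))

lemma isUnit_one_sub_gleason (z : unitBall m) :
    IsUnit (1 - gleason z.1 : H2 m E →L[ℂ] H2 m E) :=
  isUnit_one_sub_of_norm_lt_one (norm_gleason_lt_one z)

/-! ### Module maps are multiplication operators -/

/-- The symbol of an operator `A` is the function `z ↦ (v ↦ (A v)(z))` on the ball. -/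
def symbol (A : H2 m E →L[ℂ] H2 m E') (z : EuclideanSpace ℂ (Fin m)) : E →L[ℂ] E' :=
  (RKHS.kerFun (H2 m E') (origin m)).adjoint ∘L Ring.inverse (1 - gleason z) ∘L A ∘L
    RKHS.kerFun (H2 m E) (origin m)

/-- With `f = A v` and `g = (1 - gleason z)⁻¹ f`, Gleason's identity for `g` at `z` reads `g(z) -
(gleason z g)(z) = g(0)`. Its left side is `f(z)`, its right side is the symbol. -/
lemma symbol_apply (A : H2 m E →L[ℂ] H2 m E') (z : unitBall m) (v : E) :
    symbol A z.1 v = A (RKHS.kerFun (H2 m E) (origin m) v) z := by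
  set f := A (RKHS.kerFun (H2 m E) (origin m) v)
  set g := Ring.inverse (1 - gleason z.1) f with hg
  have hgf : f = g - gleason z.1 g := by
    have := congrArg (fun T : H2 m E' →L[ℂ] H2 m E' => T f)
      (Ring.mul_inverse_cancel _ (isUnit_one_sub_gleason (E := E') z))
    simpa [hg] using this.symm
  have h1 : symbol A z.1 v = g (origin m) := by
    simp [symbol, hg, f]
  rw [h1, hgf, RKHS.coe_sub, Pi.sub_apply, apply_eq_add_sum g z, ← RKHS.adjoint_kerFun z,
    gleason]
  simp

/-- The symbol is a resolvent between constant operators: `1 - gleason z` is affine in `z`, and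
inversion is differentiable at units. -/
lemma differentiableOn_symbol (A : H2 m E →L[ℂ] H2 m E') :
    DifferentiableOn ℂ (symbol A) (unitBall m) := by
  intro z hz
  have h : DifferentiableAt ℂ (fun z : EuclideanSpace ℂ (Fin m) =>
      (1 - gleason z : H2 m E' →L[ℂ] H2 m E')) z := by
    unfold gleason
    fun_prop
  have h2 : DifferentiableAt ℂ
      (Ring.inverse : (H2 m E' →L[ℂ] H2 m E') → (H2 m E' →L[ℂ] H2 m E')) (1 - gleason z) :=
    differentiableAt_inverse (isUnit_one_sub_gleason (E := E') ⟨z, hz⟩)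
  have h3 := h2.comp z h
  unfold symbol
  refine DifferentiableAt.differentiableWithinAt ?_
  exact (differentiableAt_const _).clm_comp (h3.clm_comp (differentiableAt_const _))

/-- Module maps, as bounded operators commuting with the shift. -/
def IsModuleMap (A : H2 m E →L[ℂ] H2 m E') : Prop := ∀ i f, A (shift i f) = shift i (A f)

/-- A joint eigenvector of the backward shift is a kernel function. -/
lemma eq_kerFun_of_adjoint_shift (w : unitBall m) (h : H2 m E)
    (hh : ∀ i, (shift i).adjoint h = star (w.1 i) • h) :
    h = RKHS.kerFun (H2 m E) w (h (origin m)) := by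
  refine RKHS.ext fun z => ?_
  -- For an eigenvector, Gleason's identity becomes `(1 - ∑ z_i conj(w_i)) h(z) = h(0)`.
  have h1 := apply_eq_add_sum h z
  simp only [hh, RKHS.coe_smul, Pi.smul_apply, smul_smul] at h1
  rw [← Finset.sum_smul, ← sub_eq_iff_eq_add] at h1
  rw [kerFun_apply_eq, eq_inv_smul_iff₀ (one_sub_sum_ne_zero z w), sub_smul, one_smul, h1]

/-- `A*` intertwines the backward shifts, so it sends `k_w u` to a joint eigenvector with the same
eigenvalues, which is again a kernel function at `w`. Pairing with constants identifies its vector.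
-/
lemma IsModuleMap.adjoint_kerFun {A : H2 m E →L[ℂ] H2 m E'} (hA : IsModuleMap A)
    (w : unitBall m) (u : E') :
    A.adjoint (RKHS.kerFun (H2 m E') w u) =
      RKHS.kerFun (H2 m E) w ((symbol A w.1).adjoint u) := by
  have h : A.adjoint (RKHS.kerFun (H2 m E') w u) = RKHS.kerFun (H2 m E) w
      (A.adjoint (RKHS.kerFun (H2 m E') w u) (origin m)) := by
    refine eq_kerFun_of_adjoint_shift w _ fun i => ?_
    rw [← map_smul, ← adjoint_shift_kerFun]
    refine ext_inner_right ℂ fun f => ?_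
    simp only [ContinuousLinearMap.adjoint_inner_left, hA i f]
  rw [h]
  congr 1
  refine ext_inner_right ℂ fun v => ?_
  rw [← RKHS.inner_kerFun, ContinuousLinearMap.adjoint_inner_left, RKHS.kerFun_inner,
    ContinuousLinearMap.adjoint_inner_left, symbol_apply]

lemma IsModuleMap.apply_eq {A : H2 m E →L[ℂ] H2 m E'} (hA : IsModuleMap A) (f : H2 m E)
    (z : unitBall m) : A f z = symbol A z.1 (f z) := by
  refine ext_inner_left ℂ fun u => ?_
  rw [← RKHS.kerFun_inner, ← ContinuousLinearMap.adjoint_inner_left, hA.adjoint_kerFun,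
    RKHS.kerFun_inner, ContinuousLinearMap.adjoint_inner_left]

lemma IsModuleMap.isMultiplier_symbol {A : H2 m E →L[ℂ] H2 m E'} (hA : IsModuleMap A) :
    IsMultiplier (symbol A) :=
  ⟨differentiableOn_symbol A, fun f => ⟨A f, hA.apply_eq f⟩⟩

/-! ### Operators acting on the values -/

/-- The operator `f ↦ T ∘ f` on `H²_m(E)`. -/
def lift (T : E →L[ℂ] E') : H2 m E →L[ℂ] H2 m E' :=
  LinearMap.mkContinuousOfExistsBound
    { toFun := fun f => ofCoord (fun k => T (coord f k)) <|
        ((summable_coord f).mul_left (‖T‖ ^ 2)).of_nonneg_of_le (fun _ => sq_nonneg _) fun k => by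
          rw [← mul_pow]
          gcongr
          exact T.le_opNorm _
      map_add' := fun f g => coord_ext fun k => by simp [coord_ofCoord, coord_add]
      map_smul' := fun a f => coord_ext fun k => by simp [coord_ofCoord, coord_smul] }
    ⟨‖T‖, fun f => by
      refine (pow_le_pow_iff_left₀ (norm_nonneg _) (by positivity) two_ne_zero).mp ?_
      rw [mul_pow, norm_sq_eq, norm_sq_eq, ← tsum_mul_left]
      refine (summable_coord _).tsum_le_tsum (fun k => ?_) ((summable_coord f).mul_left _)
      rw [← mul_pow]
      gcongr
      exact T.le_opNorm _⟩

lemma coord_lift (T : E →L[ℂ] E') (f : H2 m E) (k : Fin m → ℕ) :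
    coord (lift T f) k = T (coord f k) := rfl

@[simp]
lemma lift_apply (T : E →L[ℂ] E') (f : H2 m E) (z : unitBall m) : lift T f z = T (f z) := by
  refine (hasSum_apply _ z).unique ?_
  simpa [coord_lift] using (hasSum_apply f z).mapL T

lemma lift_kerFun (T : E →L[ℂ] E') (w : unitBall m) (v : E) :
    lift T (RKHS.kerFun (H2 m E) w v) = RKHS.kerFun (H2 m E') w (T v) :=
  RKHS.ext fun z => by simp [kerFun_apply_eq]

lemma norm_lift_le (T : E →L[ℂ] E') (hT : ∀ v, ‖T v‖ ≤ ‖v‖) (f : H2 m E) :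
    ‖lift T f‖ ≤ ‖f‖ := by
  refine (pow_le_pow_iff_left₀ (norm_nonneg _) (norm_nonneg _) two_ne_zero).mp ?_
  rw [norm_sq_eq, norm_sq_eq]
  refine (summable_coord _).tsum_le_tsum (fun k => ?_) (summable_coord f)
  rw [coord_lift]
  gcongr
  exact hT _

lemma norm_sq_prod (f : H2 m (WithLp 2 (E × E'))) :
    ‖f‖ ^ 2 = ‖lift (WithLp.fstL 2 ℂ E E') f‖ ^ 2 + ‖lift (WithLp.sndL 2 ℂ E E') f‖ ^ 2 := by
  rw [norm_sq_eq, norm_sq_eq, norm_sq_eq, ← (summable_coord _).tsum_add (summable_coord _)]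
  exact tsum_congr fun k => WithLp.prod_norm_sq_eq_of_L2 _

lemma norm_sq_pi {ι : Type*} [Fintype ι] (f : H2 m (PiLp 2 fun _ : ι => E)) :
    ‖f‖ ^ 2 = ∑ i, ‖lift (PiLp.proj (𝕜 := ℂ) 2 (fun _ : ι => E) i) f‖ ^ 2 := by
  simp only [norm_sq_eq]
  rw [← Summable.tsum_finsetSum fun i _ => summable_coord _]
  exact tsum_congr fun k => PiLp.norm_sq_eq_of_L2 _ _

/-! ### Finite sums of kernel functions -/

/-- The map `(v_w)_w ↦ ∑ k_w ⊗ L_w v_w`. -/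
def kerSum (L : unitBall m → E →L[ℂ] E') : (unitBall m →₀ E) →ₗ[ℂ] H2 m E' :=
  Finsupp.lsum ℂ fun w => (RKHS.kerFun (H2 m E') w ∘L L w : E →ₗ[ℂ] H2 m E')

@[simp]
lemma kerSum_single (L : unitBall m → E →L[ℂ] E') (w : unitBall m) (v : E) :
    kerSum L (Finsupp.single w v) = RKHS.kerFun (H2 m E') w (L w v) := by
  simp [kerSum]

lemma lift_kerSum (T : E' →L[ℂ] E'') (L : unitBall m → E →L[ℂ] E') (c : unitBall m →₀ E) :
    lift T (kerSum L c) = kerSum (fun w => T ∘L L w) c := by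
  have h : (lift T : H2 m E' →L[ℂ] H2 m E'').toLinearMap ∘ₗ kerSum L = kerSum fun w => T ∘L L w :=
    Finsupp.lhom_ext fun w v => by simp [lift_kerFun]
  exact LinearMap.congr_fun h c

lemma adjoint_shift_kerSum (i : Fin m) (L : unitBall m → E →L[ℂ] E') (c : unitBall m →₀ E) :
    (shift i).adjoint (kerSum L c) = kerSum (fun w => star (w.1 i) • L w) c := by
  have h : ((shift i).adjoint : H2 m E' →L[ℂ] H2 m E').toLinearMap ∘ₗ kerSum L =
      kerSum fun w => star (w.1 i) • L w :=
    Finsupp.lhom_ext fun w v => by simp [adjoint_shift_kerFun]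
  exact LinearMap.congr_fun h c

end

section

variable {m : ℕ}
  {E : Type*} [NormedAddCommGroup E] [InnerProductSpace ℂ E] [CompleteSpace E]
  {E' : Type*} [NormedAddCommGroup E'] [InnerProductSpace ℂ E'] [CompleteSpace E']
  {E'' : Type*} [NormedAddCommGroup E''] [InnerProductSpace ℂ E''] [CompleteSpace E'']
  {K : Type*} [NormedAddCommGroup K] [InnerProductSpace ℂ K] [CompleteSpace K]

/-! ### Transfer functions -/

/-- The Hilbert space `E ⊕ K^m`. -/
abbrev Colligation (m : ℕ) (E K : Type*) := WithLp 2 (E × PiLp 2 fun _ : Fin m => K)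

/-- The embedding `(x, y) ↦ (x, (conj(w_i) y)_i)` into `E ⊕ K^m`, as a map in `x` and `y`. -/
def colligationMap (L : E'' →L[ℂ] E) (G : E'' →L[ℂ] K) (w : EuclideanSpace ℂ (Fin m)) :
    E'' →L[ℂ] Colligation m E K :=
  (WithLp.prodContinuousLinearEquiv 2 ℂ E (PiLp 2 fun _ : Fin m => K)).symm.toContinuousLinearMap ∘L
    L.prod ((PiLp.continuousLinearEquiv 2 ℂ fun _ : Fin m => K).symm.toContinuousLinearMap ∘L
      ContinuousLinearMap.pi fun i => star (w i) • G)

/-- The weights `conj(w_i)` produce the factor `∑ w_i conj(z_i)`, the part of the reciprocal kernel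
that must be moved across in the lurking isometry argument. -/
lemma inner_colligationMap (L : E'' →L[ℂ] E) (G : E'' →L[ℂ] K)
    (w z : EuclideanSpace ℂ (Fin m)) (L' : E'' →L[ℂ] E) (G' : E'' →L[ℂ] K) (x y : E'') :
    ⟪colligationMap L G w x, colligationMap L' G' z y⟫_ℂ =
      ⟪L x, L' y⟫_ℂ + (∑ i, w i * star (z i)) * ⟪G x, G' y⟫_ℂ := by
  rw [WithLp.prod_inner_apply, PiLp.inner_apply, Finset.sum_mul]
  congr 1
  refine Finset.sum_congr rfl fun i _ => ?_
  change ⟪star (w i) • G x, star (z i) • G' y⟫_ℂ = _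
  rw [inner_smul_left, inner_smul_right]
  simp [mul_assoc]

/-- Separating the two inputs makes the second component of the transfer equation affine: `y = c x +
d y`. -/
lemma colligationMap_apply_eq (L : E'' →L[ℂ] E) (G : E'' →L[ℂ] K)
    (w : EuclideanSpace ℂ (Fin m)) (x : E'') :
    colligationMap L G w x =
      colligationMap (ContinuousLinearMap.id ℂ E) (0 : E →L[ℂ] K) w (L x) +
        colligationMap (0 : K →L[ℂ] E) (ContinuousLinearMap.id ℂ K) w (G x) := by
  refine (WithLp.equiv 2 _).injective (Prod.ext ?_ ?_)
  · change L x = L x + 0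
    rw [add_zero]
  · refine PiLp.ext fun i => ?_
    change star (w i) • G x = star (w i) • (0 : K) + star (w i) • G x
    rw [smul_zero, zero_add]

lemma norm_colligationMap_id (w : EuclideanSpace ℂ (Fin m)) (y : K) :
    ‖colligationMap (0 : K →L[ℂ] E) (ContinuousLinearMap.id ℂ K) w y‖ = ‖w‖ * ‖y‖ := by
  refine (pow_left_inj₀ (norm_nonneg _) (by positivity) two_ne_zero).mp ?_
  rw [WithLp.prod_norm_sq_eq_of_L2, PiLp.norm_sq_eq_of_L2, mul_pow, EuclideanSpace.norm_sq_eq,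
    Finset.sum_mul]
  change ‖(0 : E)‖ ^ 2 + ∑ i, ‖star (w i) • y‖ ^ 2 = _
  simp [norm_smul, mul_pow]

/-- A contraction `V : E ⊕ K^m → E' ⊕ K` has a transfer function: for each `w` the equation
`V (x, (conj(w_i) y)_i) = (C x, y)` determines `y = G x` and `C`. -/
lemma exists_transfer (V : Colligation m E K →L[ℂ] WithLp 2 (E' × K)) (hV : ∀ u, ‖V u‖ ≤ ‖u‖)
    (w : unitBall m) : ∃ (C : E →L[ℂ] E') (G : E →L[ℂ] K),
      (WithLp.fstL 2 ℂ E' K ∘L V) ∘L colligationMap (ContinuousLinearMap.id ℂ E) G w.1 = C ∧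
      (WithLp.sndL 2 ℂ E' K ∘L V) ∘L colligationMap (ContinuousLinearMap.id ℂ E) G w.1 = G ∧
      ∀ x y b, V (colligationMap (ContinuousLinearMap.id ℂ E) 0 w.1 x +
        colligationMap (0 : K →L[ℂ] E) (ContinuousLinearMap.id ℂ K) w.1 y) =
          WithLp.toLp 2 (b, y) → b = C x := by
  let V₁ := WithLp.fstL 2 ℂ E' K ∘L V
  let V₂ := WithLp.sndL 2 ℂ E' K ∘L V
  let c : E →L[ℂ] K := V₂ ∘L colligationMap (ContinuousLinearMap.id ℂ E) 0 w.1
  let d : K →L[ℂ] K := V₂ ∘L colligationMap (0 : K →L[ℂ] E) (ContinuousLinearMap.id ℂ K) w.1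
  -- `V` is a contraction and `y ↦ (0, (conj(w_i) y)_i)` scales norms by `‖w‖ < 1`; hence `y = c x +
  -- d y` has the unique solution `(1 - d)⁻¹ c x`.
  have hd : ‖d‖ < 1 := by
    refine lt_of_le_of_lt (ContinuousLinearMap.opNorm_le_bound _ (norm_nonneg w.1) fun y => ?_)
      (mem_ball_zero_iff.mp w.2)
    rw [← norm_colligationMap_id (E := E)]
    refine le_trans ?_ (hV _)
    refine (pow_le_pow_iff_left₀ (norm_nonneg _) (norm_nonneg _) two_ne_zero).mp ?_
    rw [WithLp.prod_norm_sq_eq_of_L2 (V _)]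
    exact le_add_of_nonneg_left (sq_nonneg _)
  have hu : IsUnit (1 - d) := isUnit_one_sub_of_norm_lt_one hd
  let G : E →L[ℂ] K := Ring.inverse (1 - d) ∘L c
  have hG : ∀ x, G x = c x + d (G x) := fun x => by
    have := congrArg (fun T : K →L[ℂ] K => T (c x)) (Ring.mul_inverse_cancel _ hu)
    rw [← sub_eq_iff_eq_add]
    exact this
  have hG' : ∀ x y, y = c x + d y → y = G x := fun x y hy => by
    have h1 : (1 - d) y = c x := by
      rw [sub_apply, sub_eq_iff_eq_add]
      exact hy
    have h2 := congrArg (fun T : K →L[ℂ] K => T y) (Ring.inverse_mul_cancel _ hu)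
    change Ring.inverse (1 - d) ((1 - d) y) = y at h2
    rw [h1] at h2
    exact h2.symm
  refine ⟨_, G, rfl, ?_, fun x y b h => ?_⟩
  · ext x
    rw [ContinuousLinearMap.comp_apply, colligationMap_apply_eq, map_add]
    exact (hG x).symm
  · have h2 : V₂ (colligationMap (ContinuousLinearMap.id ℂ E) 0 w.1 x +
        colligationMap (0 : K →L[ℂ] E) (ContinuousLinearMap.id ℂ K) w.1 y) = y :=
      congrArg (WithLp.sndL 2 ℂ E' K) h
    have hy : y = G x := hG' x y (h2.symm.trans (map_add V₂ _ _))
    have h1 : V₁ (colligationMap (ContinuousLinearMap.id ℂ E) 0 w.1 x +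
        colligationMap (0 : K →L[ℂ] E) (ContinuousLinearMap.id ℂ K) w.1 y) = b :=
      congrArg (WithLp.fstL 2 ℂ E' K) h
    rw [ContinuousLinearMap.comp_apply, colligationMap_apply_eq, ← hy]
    exact h1.symm

/-- The transfer function of a contraction acts contractively on sums of kernel functions. -/
lemma norm_kerSum_transfer_le (V : Colligation m E K →L[ℂ] WithLp 2 (E' × K))
    (hV : ∀ u, ‖V u‖ ≤ ‖u‖) (C : unitBall m → E →L[ℂ] E') (G : unitBall m → E →L[ℂ] K)
    (hC : ∀ w, (WithLp.fstL 2 ℂ E' K ∘L V) ∘L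
      colligationMap (ContinuousLinearMap.id ℂ E) (G w) w.1 = C w)
    (hG : ∀ w, (WithLp.sndL 2 ℂ E' K ∘L V) ∘L
      colligationMap (ContinuousLinearMap.id ℂ E) (G w) w.1 = G w) (c : unitBall m →₀ E) :
    ‖kerSum C c‖ ≤ ‖kerSum (fun _ => ContinuousLinearMap.id ℂ E) c‖ := by
  -- Applying `V` to the values of `f` gives `‖C c‖² + ‖G c‖² ≤ ‖c‖² + ∑ ‖M_{z_i}^* G c‖²`, each
  -- letter standing for its kernel sum. By row contractivity the last sum is at most `‖G c‖²`,
  -- which then cancels.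
  set f := kerSum (fun w => colligationMap (ContinuousLinearMap.id ℂ E) (G w) w.1) c with hf
  have h1 := norm_lift_le V hV f
  have h2 := norm_sq_prod (lift V f)
  have h3 := norm_sq_prod f
  have h4 : lift (WithLp.fstL 2 ℂ E' K) (lift V f) = kerSum C c := by
    rw [hf, lift_kerSum, lift_kerSum]
    exact congrArg (fun L => kerSum L c) (funext hC)
  have h5 : lift (WithLp.sndL 2 ℂ E' K) (lift V f) = kerSum G c := by
    rw [hf, lift_kerSum, lift_kerSum]
    exact congrArg (fun L => kerSum L c) (funext hG)
  have h6 : lift (WithLp.fstL 2 ℂ E (PiLp 2 fun _ : Fin m => K)) f =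
      kerSum (fun _ => ContinuousLinearMap.id ℂ E) c := by
    rw [hf, lift_kerSum]
    rfl
  have h7 : ‖lift (WithLp.sndL 2 ℂ E (PiLp 2 fun _ : Fin m => K)) f‖ ^ 2 ≤
      ‖kerSum G c‖ ^ 2 := by
    refine le_trans (le_of_eq ?_) (sum_norm_sq_adjoint_shift_le (kerSum G c))
    rw [norm_sq_pi]
    refine Finset.sum_congr rfl fun i _ => ?_
    rw [hf, lift_kerSum, lift_kerSum, adjoint_shift_kerSum]
    rfl
  rw [h4, h5] at h2
  rw [h6] at h3
  refine (pow_le_pow_iff_left₀ (norm_nonneg _) (norm_nonneg _) two_ne_zero).mp ?_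
  have h8 : ‖lift V f‖ ^ 2 ≤ ‖f‖ ^ 2 := by gcongr
  linarith

/-! ### Leech's theorem -/

/-- A family `C_w` that acts contractively on kernel functions is the adjoint of a module map. -/
lemma exists_moduleMap_of_norm_kerSum_le (C : unitBall m → E →L[ℂ] E')
    (hC : ∀ c, ‖kerSum C c‖ ≤ ‖kerSum (fun _ => ContinuousLinearMap.id ℂ E) c‖) :
    ∃ R : H2 m E' →L[ℂ] H2 m E, IsModuleMap R ∧ ∀ w v,
      R.adjoint (RKHS.kerFun (H2 m E) w v) = RKHS.kerFun (H2 m E') w (C w v) := by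
  obtain ⟨T, -, hT⟩ := exists_contraction_of_norm_le
    (kerSum fun _ => ContinuousLinearMap.id ℂ E) (kerSum C) hC
  have hT' : ∀ w v, T (RKHS.kerFun (H2 m E) w v) = RKHS.kerFun (H2 m E') w (C w v) :=
    fun w v => by simpa using hT (Finsupp.single w v)
  refine ⟨T.adjoint, fun i f => RKHS.ext fun z => ext_inner_left ℂ fun v => ?_, fun w v => ?_⟩
  · have h : ∀ g : H2 m E', ⟪v, T.adjoint g z⟫_ℂ = ⟪C z v, g z⟫_ℂ := fun g => by
      rw [← RKHS.kerFun_inner, ContinuousLinearMap.adjoint_inner_right, hT', RKHS.kerFun_inner]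
    rw [h, shift_apply, shift_apply, inner_smul_right, inner_smul_right, h]
  · rw [ContinuousLinearMap.adjoint_adjoint, hT']

/-- Leech's factorization theorem in norm form. -/
lemma exists_moduleMap_factor_of_norm_le {A : H2 m E →L[ℂ] H2 m E''}
    {B : H2 m E' →L[ℂ] H2 m E''} (hA : IsModuleMap A) (hB : IsModuleMap B)
    (h : ∀ f, ‖B.adjoint f‖ ≤ ‖A.adjoint f‖) :
    ∃ C : H2 m E' →L[ℂ] H2 m E, IsModuleMap C ∧ A ∘L C = B := by
  obtain ⟨S, hS⟩ := exists_factor_of_adjoint_norm_le A B h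
  let a : unitBall m → E'' →L[ℂ] E := fun w => (symbol A w.1).adjoint
  let b : unitBall m → E'' →L[ℂ] E' := fun w => (symbol B w.1).adjoint
  let g : unitBall m → E'' →L[ℂ] H2 m E'' := fun w => S ∘L RKHS.kerFun (H2 m E'') w
  let p : unitBall m → E'' →L[ℂ] Colligation m E (H2 m E'') := fun w =>
    colligationMap (a w) (g w) w.1
  let q : unitBall m → E'' →L[ℂ] WithLp 2 (E' × H2 m E'') := fun w =>
    (WithLp.prodContinuousLinearEquiv 2 ℂ E' (H2 m E'')).symm.toContinuousLinearMap ∘L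
      (b w).prod (g w)
  -- On kernel functions `hS` reads `(1 - t)⁻¹⟪a, a⟫ = (1 - t)⁻¹⟪b, b⟫ + ⟪g, g⟫` with `t = ∑ w_i
  -- conj(z_i)`. Clearing denominators gives `⟪a, a⟫ + t⟪g, g⟫ = ⟪b, b⟫ + ⟪g, g⟫`, the equality of
  -- the Gram matrices of `p` and `q`.
  obtain ⟨V, hV, hpq⟩ := exists_contraction_of_inner_eq p q fun w z x y => by
    have h1 := hS (RKHS.kerFun (H2 m E'') w x) (RKHS.kerFun (H2 m E'') z y)
    rw [hA.adjoint_kerFun, hA.adjoint_kerFun, hB.adjoint_kerFun, hB.adjoint_kerFun,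
      RKHS.inner_kerFun, RKHS.inner_kerFun, kerFun_apply_eq, kerFun_apply_eq, inner_smul_left,
      inner_smul_left] at h1
    have h2 : (starRingEnd ℂ) (1 - ∑ i, z.1 i * star (w.1 i))⁻¹ =
        (1 - ∑ i, w.1 i * star (z.1 i))⁻¹ := by
      simp [map_sum, mul_comm]
    have h0 := one_sub_sum_ne_zero w z
    rw [h2] at h1
    have h3 : ⟪q w x, q z y⟫_ℂ = ⟪b w x, b z y⟫_ℂ + ⟪g w x, g z y⟫_ℂ :=
      WithLp.prod_inner_apply _ _
    have h4 := inner_colligationMap (a w) (g w) w.1 z.1 (a z) (g z) x y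
    rw [h3, h4]
    change _ * ⟪a w x, a z y⟫_ℂ = _ * ⟪b w x, b z y⟫_ℂ + ⟪g w x, g z y⟫_ℂ at h1
    generalize (∑ i, w.1 i * star (z.1 i)) = t at h0 h1 ⊢
    field_simp at h1
    rw [← sub_eq_zero] at h1 ⊢
    rw [← neg_eq_zero, ← h1]
    ring
  choose C G hC hG hb using fun w => exists_transfer V hV w
  obtain ⟨R, hR, hR'⟩ := exists_moduleMap_of_norm_kerSum_le C
    (norm_kerSum_transfer_le V hV C G hC hG)
  refine ⟨R, hR, ?_⟩
  have key : (A ∘L R).adjoint = B.adjoint := by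
    refine ext_kerFun fun w x => ?_
    rw [ContinuousLinearMap.adjoint_comp, ContinuousLinearMap.comp_apply, hA.adjoint_kerFun,
      hR', hB.adjoint_kerFun]
    congr 1
    -- `V` sends `(a x, (conj(w_i) g x)_i)` to `(b x, g x)`, so uniqueness of the transfer solution
    -- forces `b x = C (a x)`.
    refine (hb w _ (g w x) _ ?_).symm
    rw [← colligationMap_apply_eq]
    exact hpq w x
  exact ContinuousLinearMap.adjoint.injective key

/-- Leech's factorization theorem: if the module maps `A` and `B` satisfy `ran B ⊆ ran A`, then
`B = A C` for a module map `C`. -/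
theorem exists_moduleMap_factor {A : H2 m E →L[ℂ] H2 m E''} {B : H2 m E' →L[ℂ] H2 m E''}
    (hA : IsModuleMap A) (hB : IsModuleMap B) (h : ∀ f, ∃ g, A g = B f) :
    ∃ C : H2 m E' →L[ℂ] H2 m E, IsModuleMap C ∧ A ∘L C = B := by
  obtain ⟨D, hD⟩ := exists_factor_of_range_subset A B h
  -- From `B* = D* A*` one gets `‖B* f‖ ≤ ‖D*‖ ‖A* f‖`; rescaling `A` by this constant gives the
  -- norm form, and the constant is then absorbed into `C`.
  let r : ℂ := ((‖D.adjoint‖ : ℝ) : ℂ)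
  obtain ⟨C, hC, hAC⟩ := exists_moduleMap_factor_of_norm_le (A := r • A) (B := B)
    (fun i f => by simp [hA i f]) hB fun f => by
      rw [← hD, ContinuousLinearMap.adjoint_comp, map_smulₛₗ]
      refine (D.adjoint.le_opNorm _).trans_eq ?_
      simp [norm_smul, r]
  refine ⟨r • C, fun i f => by simp [hC i f], ?_⟩
  rw [← hAC]
  ext1 f
  simp

end

section

variable {m : ℕ}
  {E : Type*} [NormedAddCommGroup E] [InnerProductSpace ℂ E] [CompleteSpace E]
  {E' : Type*} [NormedAddCommGroup E'] [InnerProductSpace ℂ E'] [CompleteSpace E']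
  {F : Type*} [NormedAddCommGroup F] [InnerProductSpace ℂ F] [CompleteSpace F]

/-! ### Pseudo-inverses of multipliers -/

/-- The multiplication operator as a bounded operator over `ℂ`. -/
def IsMultiplier.mulCLM {θ : EuclideanSpace ℂ (Fin m) → E →L[ℂ] E'} (hθ : IsMultiplier θ) :
    H2 m E →L[ℂ] H2 m E' where
  toFun := hθ.mulOp
  map_add' := map_add hθ.mulOp
  map_smul' a f := RKHS.ext fun z => by simp
  cont := hθ.mulOp.cont

@[simp]
lemma IsMultiplier.mulCLM_apply {θ : EuclideanSpace ℂ (Fin m) → E →L[ℂ] E'}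
    (hθ : IsMultiplier θ) (f : H2 m E) (z : unitBall m) : hθ.mulCLM f z = θ z (f z) :=
  hθ.mulOp_apply f z

lemma IsMultiplier.isModuleMap_mulCLM {θ : EuclideanSpace ℂ (Fin m) → E →L[ℂ] E'}
    (hθ : IsMultiplier θ) : IsModuleMap hθ.mulCLM :=
  fun i f => RKHS.ext fun z => by simp

/-- The quotient map followed by a similarity: a surjective module map with kernel `ran M_θ`. -/
lemma exists_moduleMap_of_similar {θ : EuclideanSpace ℂ (Fin m) → E →L[ℂ] E'}
    (hθ : IsMultiplier θ) (hsim : Similar m hθ.QuotientModule (H2 m F)) :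
    ∃ Φ : H2 m E' →L[ℂ] H2 m F, IsModuleMap Φ ∧ Function.Surjective Φ ∧
      ∀ f, Φ f = 0 ↔ ∃ g, hθ.mulCLM g = f := by
  obtain ⟨X⟩ := hsim
  let N := LinearMap.range (hθ.mulOp : H2 m E →ₗ[MvPolynomial (Fin m) ℂ] H2 m E')
  let T : H2 m E' →ₗ[MvPolynomial (Fin m) ℂ] H2 m F :=
    (X.toLinearEquiv : hθ.QuotientModule →ₗ[MvPolynomial (Fin m) ℂ] H2 m F) ∘ₗ N.mkQ
  have hT : Continuous T := X.continuous.comp continuous_quot_mk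
  -- Complex scalars act through the constant polynomials, so polynomial linearity implies complex
  -- linearity.
  have hTs : ∀ (a : ℂ) f, T (a • f) = a • T f := fun a f => by
    rw [← one_smul (MvPolynomial (Fin m) ℂ) f, ← smul_assoc, map_smul, smul_assoc, one_smul,
      one_smul]
  refine ⟨{ toFun := T, map_add' := map_add T, map_smul' := hTs, cont := hT },
    fun i f => map_smul T (MvPolynomial.X i : MvPolynomial (Fin m) ℂ) f,
    X.surjective.comp N.mkQ_surjective, fun f => ?_⟩
  change X (N.mkQ f) = 0 ↔ _
  rw [map_eq_zero_iff X X.injective, Submodule.mkQ_apply, Submodule.Quotient.mk_eq_zero]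
  rfl

/-- If `ran M_θ` is the kernel of a surjective module map, then `θ` has a generalized inverse. -/
theorem IsMultiplier.exists_generalized_inverse {θ : EuclideanSpace ℂ (Fin m) → E →L[ℂ] E'}
    (hθ : IsMultiplier θ) {Φ : H2 m E' →L[ℂ] H2 m F} (hΦ : IsModuleMap Φ)
    (hsurj : Function.Surjective Φ) (hker : ∀ f, Φ f = 0 ↔ ∃ g, hθ.mulCLM g = f) :
    ∃ ψ : EuclideanSpace ℂ (Fin m) → E' →L[ℂ] E, IsMultiplier ψ ∧
      ∀ z ∈ unitBall m, (θ z).comp ((ψ z).comp (θ z)) = θ z := by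
  -- Surjectivity of `Φ` is the range inclusion `ran 1 ⊆ ran Φ`, so Leech's theorem yields a right
  -- inverse that is a module map.
  obtain ⟨η, hη, hΦη⟩ := exists_moduleMap_factor (B := ContinuousLinearMap.id ℂ (H2 m F)) hΦ
    (fun _ _ => rfl) fun f => hsurj f
  have hΦη' : ∀ f, Φ (η f) = f := fun f => congrArg (fun T : H2 m F →L[ℂ] H2 m F => T f) hΦη
  have hP : IsModuleMap (ContinuousLinearMap.id ℂ (H2 m E') - η ∘L Φ) := fun i f => by
    simp [hΦ i f, hη i (Φ f)]
  -- `1 - ηΦ` takes values in `ker Φ = ran M_θ`, so Leech's theorem applies a second time.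
  obtain ⟨Ψ, hΨ, hθΨ⟩ := exists_moduleMap_factor hθ.isModuleMap_mulCLM hP fun f =>
    (hker _).mp (by simp [hΦη'])
  refine ⟨symbol Ψ, hΨ.isMultiplier_symbol, fun z hz => ?_⟩
  ext v
  -- The kernel function at the origin is the constant `v`. Since `Φ` kills `θ f`, the projection `1
  -- - ηΦ` fixes it; evaluating at `z` gives the pointwise identity.
  let f := RKHS.kerFun (H2 m E) (origin m) v
  have h0 : Φ (hθ.mulCLM f) = 0 := (hker _).mpr ⟨f, rfl⟩
  have h1 := congrArg (fun T : H2 m E' →L[ℂ] H2 m E' => T (hθ.mulCLM f) ⟨z, hz⟩) hθΨ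
  simp only [ContinuousLinearMap.comp_apply, sub_apply, ContinuousLinearMap.id_apply, h0,
    map_zero, sub_zero, IsMultiplier.mulCLM_apply, hΨ.apply_eq] at h1
  simpa [f] using h1

end

end DruryArveson

end

theorem mainTheorem1 {m : ℕ}
    {E : Type*} [NormedAddCommGroup E] [InnerProductSpace ℂ E] [CompleteSpace E]
    {E' : Type*} [NormedAddCommGroup E'] [InnerProductSpace ℂ E'] [CompleteSpace E']
    {F : Type*} [NormedAddCommGroup F] [InnerProductSpace ℂ F] [CompleteSpace F]
    (θ : EuclideanSpace ℂ (Fin m) → E →L[ℂ] E') (hθ : DruryArveson.IsMultiplier θ)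
    (hclosed : IsClosed (Set.range hθ.mulOp))
    (hsim : DruryArveson.Similar m hθ.QuotientModule (DruryArveson.H2 m F)) :
    ∃ ψ : EuclideanSpace ℂ (Fin m) → E' →L[ℂ] E, DruryArveson.IsMultiplier ψ ∧
      ∀ z ∈ DruryArveson.unitBall m, (θ z).comp ((ψ z).comp (θ z)) = θ z := by
  obtain ⟨Φ, hΦ, hsurj, hker⟩ := DruryArveson.exists_moduleMap_of_similar hθ hsim
  exact hθ.exists_generalized_inverse hΦ hsurj hker
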